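/- **Definitions.** A *JavaScript base execution* $X$ consists of a set of events, with relations $\mathsf{sb}$ (sequenced-before), $\mathsf{asw}$ (additional-synchronizes-with) and a byte-wise reads-from relation $\mathsf{rbf}$, where $(k,W,R)\in\mathsf{rbf}$ means that $R$ reads its byte at index $k$ from $W$. An event has a mode (Unordered, SeqCst or Init), a block, an index $i$, lists of bytes read and written, and a tear-free flag; $\mathrm{range}_r$ and $\mathrm{range}_w$ are the sets of byte locations of its block starting at $i$ that it reads and writes. Put $W\,\mathsf{rf}\,R$ iff $(k,W,R)\in\mathsf{rbf}$ for some $k$; $\mathsf{sw}=\{(A,B): A\,\mathsf{rf}\,B,\ \mathrm{range}_w(A)=\mathrm{range}_r(B),\ A,B \text{ SeqCst}\}\cup\mathsf{asw}$; $\mathsf{init}=\{(A,B): A \text{ Init},\ B\text{ not Init},\ A\text{ and }B\text{ overlap}\}$; $\mathsf{hb}=(\mathsf{sb}\cup\mathsf{sw}\cup\mathsf{init})^+$. The thread-local part of $X$ is well formed if $\mathsf{sb}$ is a strict partial order on the non-Init events that is a disjoint union of total orders (the threads), $\mathsf{asw}$ relates events of $X$, every event reads or writes, an event that does both (an RMW)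 is SeqCst and reads and writes the same range, Init events only write, and distinct Init events do not overlap. Together with a relation $\mathsf{tot}$, $X$ is *well formed* if moreover every byte read by an event is justified in $\mathsf{rbf}$ by exactly one event, which is different from the reader and writes the same value at the same location, and $\mathsf{tot}$ is a strict total order on the events. It is *valid* (revised model) if: (1) $\mathsf{hb}\subseteq\mathsf{tot}$; (2) $W\,\mathsf{rf}\,R$ implies $\neg(R\,\mathsf{hb}\,W)$; (3) if $(k,W,R)\in\mathsf{rbf}$, there is no $W'$ that writes byte $k$ of the block of $R$ with $W\,\mathsf{hb}\,W'\,\mathsf{hb}\,R$; (4) every tear-free $R$ reads from at most one tear-free $W$ with $\mathrm{range}_w(W)=\mathrm{range}_r(R)$; (5) if $W\,\mathsf{rf}\,R$ and $W\,\mathsf{hb}\,R$, there is no SeqCst $W'$ with $W\,\mathsf{tot}\,W'\,\mathsf{tot}\,R$ such that [$\mathrm{range}_w(W')=\mathrm{range}_r(R)$ and $W\,\mathsf{sw}\,R$] or [$\mathrm{range}_w(W)=\mathrm{range}_w(W')$, $W$ is SeqCst and $W'\,\mathsf{hb}\,R$] or [$\mathrm{range}_w(W')=\mathrm{range}_r(R)$,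 $W\,\mathsf{hb}\,W'$ and $R$ is SeqCst]. A *mixed-size ARMv8 execution* $Y$ consists of events (loads: plain, acquire $A$, acquirePC $Q$; stores: plain, release $L$, initial; each possibly exclusive; barriers), program order $\mathsf{po}$ (total on each thread, not involving initial writes), dependencies $\mathsf{addr},\mathsf{data},\mathsf{ctrl}\subseteq\mathsf{po}$ starting at loads ($\mathsf{data}$ ending at stores, $\mathsf{addr}$ at loads or stores), pairs $\mathsf{rmw}\subseteq\mathsf{po}$ of a load exclusive and the next exclusive, which is a store to the same locations, and, for each byte location $\ell$, a relation $\mathsf{rbf}_\ell$ giving each load of $\ell$ exactly one store to $\ell$ of the same value, and a strict total order $\mathsf{cob}_\ell$ on the stores to $\ell$ with initial writes first. Put $\mathsf{frb}_\ell=\mathsf{rbf}_\ell^{-1};\mathsf{cob}_\ell$; let $\mathsf{rf},\mathsf{co},\mathsf{fr}$ be the unions of $\mathsf{rbf}_\ell,\mathsf{cob}_\ell,\mathsf{frb}_\ell$ over $\ell$, with suffix $\mathsf e$ / $\mathsf i$ for their restrictions to different threads / the same thread (an initial write is in no event's thread but its own), and - $\mathsf{obs}=\mathsf{rfe}\cup\mathsf{fre}\cup\mathsf{coe}$;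 - $\mathsf{dob}=\mathsf{addr}\cup\mathsf{data}\cup\mathsf{ctrl};[W]\cup(\mathsf{ctrl}\cup\mathsf{addr};\mathsf{po});[\mathrm{ISB}];\mathsf{po};[R]\cup\mathsf{addr};\mathsf{po};[W]\cup(\mathsf{ctrl}\cup\mathsf{data});\mathsf{coi}\cup(\mathsf{addr}\cup\mathsf{data});\mathsf{rfi}$; - $\mathsf{aob}=\mathsf{rmw}\cup[\mathrm{range}(\mathsf{rmw})];\mathsf{rfi};[A\cup Q]$; - $\mathsf{bob}=\mathsf{po};[\mathrm{dmb.full}];\mathsf{po}\cup[L];\mathsf{po};[A]\cup[R];\mathsf{po};[\mathrm{dmb.ld}];\mathsf{po}\cup[A\cup Q];\mathsf{po}\cup[W];\mathsf{po};[\mathrm{dmb.st}];\mathsf{po};[W]\cup\mathsf{po};[L]\cup\mathsf{po};[L];\mathsf{coi}$; - $\mathsf{ob}=(\mathsf{obs}\cup\mathsf{dob}\cup\mathsf{aob}\cup\mathsf{bob})^+$. $Y$ is *valid* if for every $\ell$ the relation $\mathsf{po}_\ell\cup\mathsf{frb}_\ell\cup\mathsf{cob}_\ell\cup\mathsf{rbf}_\ell$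 is acyclic ($\mathsf{po}_\ell$ being $\mathsf{po}$ between accesses to $\ell$), $\mathsf{ob}$ is irreflexive, and $\mathsf{rmw}\cap(\mathsf{fre};\mathsf{coe})=\emptyset$. *Compilation scheme.* Each JavaScript event is implemented by ARMv8 events with the same block, index and bytes: an Unordered load / store by a plain load / store (`ldr`/`str`), a SeqCst load / store by an acquire load / release store (`ldar`/`stlr`), an RMW by an $\mathsf{rmw}$ pair of an acquire load exclusive and a release store exclusive (`ldaxr`/`stlxr`), and an Init event by an initial write; $Y$ has no other events and no other $\mathsf{rmw}$ pairs. $X$ and $Y$ share the base execution if $Y$ arises from $X$ in this way, $\mathsf{po}$ is the order induced by $\mathsf{sb}$ together with the $\mathsf{rmw}$ pairs, and $\mathsf{rbf}$ of $X$ is the image of that of $Y$. **Theorem (jsmm_compilation).** Let $X$ be a JavaScript base execution with well-formed thread-local part and $\mathsf{asw}=\emptyset$ (a fixed collection of threads on already initialised buffers), all of whose non-Init accesses are generated by typed arrays (width 1, 2, 4 or 8 bytes, index divisible by the width). Let $Y$ be a well-formed, valid ARMv8 execution sharing the base execution of $X$. Let $T$ be the relation on events of $X$ given by $\mathsf{sb}\cup\mathsf{init}$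 together with the image of $\mathsf{obs}\cap(L\cup A)^2$. Then there is a strict total order $\mathsf{tot}$ on the events of $X$ that contains $T$, and for every such $\mathsf{tot}$ the JavaScript candidate execution $(X,\mathsf{tot})$ is well formed and valid in the revised model. -/

import Mathlib

namespace RelaxedMemory

/-- `r` is acyclic: its transitive closure is irreflexive. -/
def Acyclic {α : Type*} (r : α → α → Prop) : Prop :=
  ∀ a, ¬ Relation.TransGen r a a

/-- `r` is a strict total order on the set `s` (and relates nothing outside `s`). -/
structure StrictTotalOn {α : Type*} (s : Set α) (r : α → α → Prop) : Prop where
  mem : ∀ a b, r a b → a ∈ s ∧ b ∈ s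
  irrefl : ∀ a, ¬ r a a
  trans : ∀ a b c, r a b → r b c → r a c
  total : ∀ a ∈ s, ∀ b ∈ s, a ≠ b → r a b ∨ r b a

/-- `r` is a program order on `s`: a strict partial order on `s` which is a disjoint union of
total orders, one for each thread. -/
structure ThreadOrderOn {α : Type*} (s : Set α) (r : α → α → Prop) : Prop where
  mem : ∀ a b, r a b → a ∈ s ∧ b ∈ s
  irrefl : ∀ a, ¬ r a a
  trans : ∀ a b c, r a b → r b c → r a c
  same_thread_of_pred : ∀ a b c, r a c → r b c → a = b ∨ r a b ∨ r b a
  same_thread_of_succ : ∀ a b c, r c a → r c b → a = b ∨ r a b ∨ r b a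

/-- `tot` is a strict total order on `s` that contains `r`. -/
structure LinearExtension {α : Type*} (s : Set α) (r tot : α → α → Prop) : Prop where
  strictTotal : StrictTotalOn s tot
  contains : ∀ a b, r a b → tot a b

/-- The byte locations `[index, index + n)` of the buffer `block`. Locations in different blocks
are different. -/
def byteRange {Addr : Type*} (block : Addr) (index n : ℕ) : Set (Addr × ℕ) :=
  {l | l.1 = block ∧ index ≤ l.2 ∧ l.2 < index + n}

end RelaxedMemory

/-! ### The revised JavaScript model -/

namespace JS

open RelaxedMemory

inductive Mode where
  | unordered
  | seqCst
  | init

/-- A JavaScript shared memory event. -/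
structure Event (Addr : Type*) where
  ord : Mode
  block : Addr
  index : ℕ
  reads : List UInt8
  writes : List UInt8
  tearfree : Bool

namespace Event

variable {Addr : Type*}

def rangeR (E : Event Addr) : Set (Addr × ℕ) := byteRange E.block E.index E.reads.length

def rangeW (E : Event Addr) : Set (Addr × ℕ) := byteRange E.block E.index E.writes.length

def range (E : Event Addr) : Set (Addr × ℕ) := E.rangeR ∪ E.rangeW

def overlap (A B : Event Addr) : Prop := (A.range ∩ B.range).Nonempty

/-- A read-modify-write event. -/
def IsRMW (E : Event Addr) : Prop := E.reads ≠ [] ∧ E.writes ≠ []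

/-- The number of bytes that the event accesses. -/
def width (E : Event Addr) : ℕ := max E.reads.length E.writes.length

/-- An access through a typed array: 1, 2, 4 or 8 bytes wide, at a multiple of the width. -/
def Aligned (E : Event Addr) : Prop :=
  (E.width = 1 ∨ E.width = 2 ∨ E.width = 4 ∨ E.width = 8) ∧ E.width ∣ E.index

end Event

/-- A JavaScript candidate execution without its total order: a set `evs` of event names labelled
by events, sequenced-before, additional-synchronizes-with, and the byte-wise reads-from relation,
where `rbf k W R` says that `R` reads the byte at index `k` from `W`. -/
structure BaseExecution (Addr ι : Type*) where
  evs : Set ι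
  lab : ι → Event Addr
  sb : ι → ι → Prop
  asw : ι → ι → Prop
  rbf : ℕ → ι → ι → Prop

/-- A JavaScript candidate execution. -/
structure CandidateExecution (Addr ι : Type*) extends BaseExecution Addr ι where
  tot : ι → ι → Prop

namespace BaseExecution

variable {Addr ι : Type*} (X : BaseExecution Addr ι)

/-- The events other than the initialising writes. -/
def nonInit : Set ι := {A | A ∈ X.evs ∧ (X.lab A).ord ≠ Mode.init}

/-- Reads-from. -/
def rf (A B : ι) : Prop := ∃ k, X.rbf k A B

/-- Synchronizes-with, in its revised form. -/
def sw (A B : ι) : Prop :=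
  (X.rf A B ∧ (X.lab A).rangeW = (X.lab B).rangeR ∧
    (X.lab A).ord = Mode.seqCst ∧ (X.lab B).ord = Mode.seqCst) ∨
  X.asw A B

/-- An initialising write and another event that overlaps it. -/
def initBefore (A B : ι) : Prop :=
  A ∈ X.evs ∧ B ∈ X.evs ∧ (X.lab A).ord = Mode.init ∧ (X.lab B).ord ≠ Mode.init ∧
    (X.lab A).overlap (X.lab B)

/-- Happens-before. -/
def hb : ι → ι → Prop :=
  Relation.TransGen fun A B => X.sb A B ∨ X.sw A B ∨ X.initBefore A B

/-- Well-formedness of the components fixed by the thread-local semantics. -/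
structure ThreadLocalWF : Prop where
  /-- program order is total on each thread and does not involve the initialising writes -/
  sb_order : ThreadOrderOn X.nonInit X.sb
  asw_mem : ∀ A B, X.asw A B → A ∈ X.evs ∧ B ∈ X.evs
  /-- every event is a memory access -/
  access : ∀ A ∈ X.evs, (X.lab A).reads ≠ [] ∨ (X.lab A).writes ≠ []
  /-- read-modify-writes are atomic, and read and write the same locations -/
  rmw_seqCst : ∀ A ∈ X.evs, (X.lab A).IsRMW → (X.lab A).ord = Mode.seqCst
  rmw_range : ∀ A ∈ X.evs, (X.lab A).IsRMW → (X.lab A).reads.length = (X.lab A).writes.length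
  /-- initialising events only write, and no location is initialised twice -/
  init_write : ∀ A ∈ X.evs, (X.lab A).ord = Mode.init → (X.lab A).reads = []
  init_disjoint : ∀ A ∈ X.evs, ∀ B ∈ X.evs, (X.lab A).ord = Mode.init →
    (X.lab B).ord = Mode.init → A ≠ B → ¬ (X.lab A).overlap (X.lab B)

/-- All accesses other than the initialisation are generated by typed arrays. -/
def TypedArrayAccesses : Prop := ∀ A ∈ X.nonInit, (X.lab A).Aligned

/-- The execution has only memory accesses by a fixed collection of threads on initialised buffers:
there is no thread creation or suspension, hence no additional synchronization. -/
def NoAdditionalSync : Prop := ∀ A B, ¬ X.asw A B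

/-- Well-formedness of reads-from: every byte that is read is justified by exactly one write, which
is a different event and writes the same value at the same location. -/
structure RbfWF : Prop where
  mem : ∀ k A B, X.rbf k A B → A ∈ X.evs ∧ B ∈ X.evs
  ne : ∀ k A B, X.rbf k A B → A ≠ B
  block_eq : ∀ k A B, X.rbf k A B → (X.lab A).block = (X.lab B).block
  writes_mem : ∀ k A B, X.rbf k A B → ((X.lab A).block, k) ∈ (X.lab A).rangeW
  reads_mem : ∀ k A B, X.rbf k A B → ((X.lab B).block, k) ∈ (X.lab B).rangeR
  value : ∀ k A B, X.rbf k A B →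
    (X.lab A).writes[k - (X.lab A).index]? = (X.lab B).reads[k - (X.lab B).index]?
  justified : ∀ B ∈ X.evs, ∀ k, ((X.lab B).block, k) ∈ (X.lab B).rangeR → ∃! A, X.rbf k A B

/-- Adjoin a total order. -/
def withTot (tot : ι → ι → Prop) : CandidateExecution Addr ι := { X with tot := tot }

end BaseExecution

namespace CandidateExecution

variable {Addr ι : Type*} (X : CandidateExecution Addr ι)

structure WellFormed : Prop where
  threadLocal : X.ThreadLocalWF
  rbf_wf : X.RbfWF
  tot_order : StrictTotalOn X.evs X.tot

def HBConsistency1 : Prop := ∀ A B, X.hb A B → X.tot A B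

def HBConsistency2 : Prop := ∀ W R, X.rf W R → ¬ X.hb R W

def HBConsistency3 : Prop :=
  ∀ k W R, X.rbf k W R →
    ¬ ∃ W', X.hb W W' ∧ X.hb W' R ∧ ((X.lab R).block, k) ∈ (X.lab W').rangeW

def TearFreeReads : Prop :=
  ∀ R ∈ X.evs, (X.lab R).tearfree = true →
    {W | X.rf W R ∧ (X.lab W).tearfree = true ∧
      (X.lab W).rangeW = (X.lab R).rangeR}.encard ≤ 1

/-- The revised rule for sequentially consistent atomics. -/
def SCAtomics : Prop :=
  ∀ W R, X.rf W R ∧ X.hb W R →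
    ¬ ∃ W', (X.lab W').ord = Mode.seqCst ∧ X.tot W W' ∧ X.tot W' R ∧
      (((X.lab W').rangeW = (X.lab R).rangeR ∧ X.sw W R) ∨
       ((X.lab W).rangeW = (X.lab W').rangeW ∧ (X.lab W).ord = Mode.seqCst ∧ X.hb W' R) ∨
       ((X.lab W').rangeW = (X.lab R).rangeR ∧ X.hb W W' ∧ (X.lab R).ord = Mode.seqCst))

/-- Validity in the revised JavaScript model. -/
structure Valid : Prop where
  hb1 : X.HBConsistency1
  hb2 : X.HBConsistency2
  hb3 : X.HBConsistency3
  tearFree : X.TearFreeReads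
  scAtomics : X.SCAtomics

end CandidateExecution

end JS

/-! ### The mixed-size axiomatic ARMv8 model -/

namespace Arm

open RelaxedMemory

/-- The strength of a load: plain, acquire (`ldar`, `ldaxr`), acquirePC (`ldapr`). -/
inductive ReadOrd where
  | plain
  | acquire
  | acquirePC

/-- The strength of a store: plain, release (`stlr`, `stlxr`), or a write of the initial state. -/
inductive WriteOrd where
  | plain
  | release
  | init

/-- ARMv8 events; `excl` marks the exclusive loads and stores. -/
inductive Event (Addr : Type*) where
  | read (ord : ReadOrd) (excl : Bool) (block : Addr) (index : ℕ) (bytes : List UInt8)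
  | write (ord : WriteOrd) (excl : Bool) (block : Addr) (index : ℕ) (bytes : List UInt8)
  | dmbFull
  | dmbLd
  | dmbSt
  | isb

namespace Event

variable {Addr : Type*}

def IsRead : Event Addr → Prop
  | read .. => True
  | _ => False

def IsWrite : Event Addr → Prop
  | write .. => True
  | _ => False

def IsInit : Event Addr → Prop
  | write WriteOrd.init .. => True
  | _ => False

/-- Acquire loads. -/
def IsA : Event Addr → Prop
  | read ReadOrd.acquire .. => True
  | _ => False

/-- AcquirePC loads. -/
def IsQ : Event Addr → Prop
  | read ReadOrd.acquirePC .. => True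
  | _ => False

/-- Release stores. -/
def IsL : Event Addr → Prop
  | write WriteOrd.release .. => True
  | _ => False

def IsExclusive : Event Addr → Prop
  | read _ e .. => e = true
  | write _ e .. => e = true
  | _ => False

def rangeR : Event Addr → Set (Addr × ℕ)
  | read _ _ b i v => byteRange b i v.length
  | _ => ∅

def rangeW : Event Addr → Set (Addr × ℕ)
  | write _ _ b i v => byteRange b i v.length
  | _ => ∅

def range (e : Event Addr) : Set (Addr × ℕ) := e.rangeR ∪ e.rangeW

/-- The byte that an access reads or writes at index `k` of its block. -/
def byteAt : Event Addr → ℕ → Option UInt8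
  | read _ _ _ i v, k => v[k - i]?
  | write _ _ _ i v, k => v[k - i]?
  | _, _ => none

end Event

/-- A mixed-size ARMv8 candidate execution: event names with their labels, program order, address,
data and control dependencies, the pairs `rmw` of a load exclusive and its successful store
exclusive, and, for each byte location, reads-from `rbf` and coherence `cob`. -/
structure Execution (Addr κ : Type*) where
  evs : Set κ
  lab : κ → Event Addr
  po : κ → κ → Prop
  addr : κ → κ → Prop
  data : κ → κ → Prop
  ctrl : κ → κ → Prop
  rmw : κ → κ → Prop
  rbf : Addr × ℕ → κ → κ → Prop
  cob : Addr × ℕ → κ → κ → Prop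

namespace Execution

variable {Addr κ : Type*} (Y : Execution Addr κ)

/-- Well-formedness of ARMv8 candidate executions. -/
structure WellFormed : Prop where
  /-- program order is total on each thread and does not involve the initial writes -/
  po_order : ThreadOrderOn {a | a ∈ Y.evs ∧ ¬ (Y.lab a).IsInit} Y.po
  /-- dependencies run forward in program order, from loads -/
  addr_wf : ∀ a b, Y.addr a b →
    Y.po a b ∧ (Y.lab a).IsRead ∧ ((Y.lab b).IsRead ∨ (Y.lab b).IsWrite)
  data_wf : ∀ a b, Y.data a b → Y.po a b ∧ (Y.lab a).IsRead ∧ (Y.lab b).IsWrite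
  ctrl_wf : ∀ a b, Y.ctrl a b → Y.po a b ∧ (Y.lab a).IsRead
  /-- `rmw` pairs a load exclusive with the next exclusive, a store to the same locations -/
  rmw_wf : ∀ a b, Y.rmw a b →
    Y.po a b ∧ (Y.lab a).IsRead ∧ (Y.lab a).IsExclusive ∧
      (Y.lab b).IsWrite ∧ (Y.lab b).IsExclusive ∧ (Y.lab a).rangeR = (Y.lab b).rangeW ∧
      ∀ c, Y.po a c → Y.po c b → ¬ (Y.lab c).IsExclusive
  /-- every byte that is read is justified by exactly one write, of the same value -/
  rbf_wf : ∀ l a b, Y.rbf l a b →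
    a ∈ Y.evs ∧ b ∈ Y.evs ∧ l ∈ (Y.lab a).rangeW ∧ l ∈ (Y.lab b).rangeR ∧
      (Y.lab a).byteAt l.2 = (Y.lab b).byteAt l.2
  rbf_justified : ∀ b ∈ Y.evs, ∀ l ∈ (Y.lab b).rangeR, ∃! a, Y.rbf l a b
  /-- coherence totally orders the writes to each byte, those of the initial state first -/
  cob_order : ∀ l, StrictTotalOn {a | a ∈ Y.evs ∧ l ∈ (Y.lab a).rangeW} (Y.cob l)
  cob_init : ∀ l, ∀ a ∈ Y.evs, ∀ b ∈ Y.evs, l ∈ (Y.lab a).rangeW → l ∈ (Y.lab b).rangeW →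
    (Y.lab a).IsInit → ¬ (Y.lab b).IsInit → Y.cob l a b

/-- Byte-wise from-reads. -/
def frb (l : Addr × ℕ) (r w : κ) : Prop := ∃ w', Y.rbf l w' r ∧ Y.cob l w' w

def rf (a b : κ) : Prop := ∃ l, Y.rbf l a b

def co (a b : κ) : Prop := ∃ l, Y.cob l a b

def fr (a b : κ) : Prop := ∃ l, Y.frb l a b

/-- Two events of the same thread. -/
def int (a b : κ) : Prop := a = b ∨ Y.po a b ∨ Y.po b a

def rfe (a b : κ) : Prop := Y.rf a b ∧ ¬ Y.int a b

def coe (a b : κ) : Prop := Y.co a b ∧ ¬ Y.int a b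

def fre (a b : κ) : Prop := Y.fr a b ∧ ¬ Y.int a b

def rfi (a b : κ) : Prop := Y.rf a b ∧ Y.int a b

def coi (a b : κ) : Prop := Y.co a b ∧ Y.int a b

/-- Observed-before. -/
def obs (a b : κ) : Prop := Y.rfe a b ∨ Y.fre a b ∨ Y.coe a b

/-- Dependency-ordered-before. -/
inductive dob : κ → κ → Prop
  | addr {a b} : Y.addr a b → dob a b
  | data {a b} : Y.data a b → dob a b
  | ctrl_write {a b} : Y.ctrl a b → (Y.lab b).IsWrite → dob a b
  | ctrl_isb {a b c} : Y.ctrl a b → Y.lab b = Event.isb → Y.po b c → (Y.lab c).IsRead → dob a c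
  | addr_po_isb {a b c d} : Y.addr a b → Y.po b c → Y.lab c = Event.isb → Y.po c d →
      (Y.lab d).IsRead → dob a d
  | addr_po_write {a b c} : Y.addr a b → Y.po b c → (Y.lab c).IsWrite → dob a c
  | ctrl_coi {a b c} : Y.ctrl a b → Y.coi b c → dob a c
  | data_coi {a b c} : Y.data a b → Y.coi b c → dob a c
  | addr_rfi {a b c} : Y.addr a b → Y.rfi b c → dob a c
  | data_rfi {a b c} : Y.data a b → Y.rfi b c → dob a c

/-- Atomic-ordered-before. -/
inductive aob : κ → κ → Prop
  | rmw {a b} : Y.rmw a b → aob a b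
  | rmw_rfi {a b c} : Y.rmw a b → Y.rfi b c → (Y.lab c).IsA ∨ (Y.lab c).IsQ → aob b c

/-- Barrier-ordered-before. -/
inductive bob : κ → κ → Prop
  | dmb_full {a b c} : Y.po a b → Y.lab b = Event.dmbFull → Y.po b c → bob a c
  | release_acquire {a b} : (Y.lab a).IsL → Y.po a b → (Y.lab b).IsA → bob a b
  | dmb_ld {a b c} : (Y.lab a).IsRead → Y.po a b → Y.lab b = Event.dmbLd → Y.po b c → bob a c
  | acquire {a b} : (Y.lab a).IsA ∨ (Y.lab a).IsQ → Y.po a b → bob a b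
  | dmb_st {a b c} : (Y.lab a).IsWrite → Y.po a b → Y.lab b = Event.dmbSt → Y.po b c →
      (Y.lab c).IsWrite → bob a c
  | release {a b} : Y.po a b → (Y.lab b).IsL → bob a b
  | release_coi {a b c} : Y.po a b → (Y.lab b).IsL → Y.coi b c → bob a c

/-- Ordered-before. -/
def ob : κ → κ → Prop :=
  Relation.TransGen fun a b => Y.obs a b ∨ Y.dob a b ∨ Y.aob a b ∨ Y.bob a b

/-- Program order between accesses to the byte location `l`. -/
def poByte (l : Addr × ℕ) (a b : κ) : Prop :=
  Y.po a b ∧ l ∈ (Y.lab a).range ∧ l ∈ (Y.lab b).range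

/-- Validity in the mixed-size ARMv8 model: the internal visibility requirement for each byte, the
external visibility requirement, and atomicity of exclusive pairs. -/
structure Valid : Prop where
  internal : ∀ l, Acyclic fun a b => Y.poByte l a b ∨ Y.frb l a b ∨ Y.cob l a b ∨ Y.rbf l a b
  external : ∀ a, ¬ Y.ob a a
  atomic : ∀ a b, Y.rmw a b → ¬ ∃ c, Y.fre a c ∧ Y.coe c b

/-- Observed-before restricted to release and acquire events. -/
def obsLA (a b : κ) : Prop :=
  Y.obs a b ∧ ((Y.lab a).IsL ∨ (Y.lab a).IsA) ∧ ((Y.lab b).IsL ∨ (Y.lab b).IsA)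

end Execution

end Arm

/-! ### The compilation scheme -/

namespace Compilation

/-- `ldar` for sequentially consistent loads, `ldr` for non-atomic ones. -/
def readOrd : JS.Mode → Arm.ReadOrd
  | JS.Mode.seqCst => Arm.ReadOrd.acquire
  | _ => Arm.ReadOrd.plain

/-- `stlr` for sequentially consistent stores, `str` for non-atomic ones; the initial contents of
the buffer become part of the initial state. -/
def writeOrd : JS.Mode → Arm.WriteOrd
  | JS.Mode.seqCst => Arm.WriteOrd.release
  | JS.Mode.unordered => Arm.WriteOrd.plain
  | JS.Mode.init => Arm.WriteOrd.init

variable {Addr ι κ : Type*}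

/-- The load (`excl = false`) or load exclusive (`excl = true`) that implements `E`. -/
def readEvent (E : JS.Event Addr) (excl : Bool) : Arm.Event Addr :=
  Arm.Event.read (readOrd E.ord) excl E.block E.index E.reads

/-- The store or store exclusive that implements `E`. -/
def writeEvent (E : JS.Event Addr) (excl : Bool) : Arm.Event Addr :=
  Arm.Event.write (writeOrd E.ord) excl E.block E.index E.writes

/-- The JavaScript execution `X` and the ARMv8 execution `Y` share the same base execution, where
the events of `Y` arise by compilation from those of `X`; `src` gives the JavaScript event that an
ARMv8 event implements. -/
structure CompilesTo (X : JS.BaseExecution Addr ι) (Y : Arm.Execution Addr κ) (src : κ → ι) :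
    Prop where
  src_mem : ∀ a ∈ Y.evs, src a ∈ X.evs
  /-- a load is implemented by one load, a store by one store -/
  load : ∀ A ∈ X.evs, (X.lab A).writes = [] →
    ∃ a, {c | c ∈ Y.evs ∧ src c = A} = {a} ∧ Y.lab a = readEvent (X.lab A) false
  store : ∀ A ∈ X.evs, (X.lab A).reads = [] →
    ∃ a, {c | c ∈ Y.evs ∧ src c = A} = {a} ∧ Y.lab a = writeEvent (X.lab A) false
  /-- a read-modify-write is implemented by a load exclusive / store exclusive pair -/
  rmw : ∀ A ∈ X.evs, (X.lab A).IsRMW →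
    ∃ a b, {c | c ∈ Y.evs ∧ src c = A} = {a, b} ∧ Y.lab a = readEvent (X.lab A) true ∧
      Y.lab b = writeEvent (X.lab A) true ∧ Y.rmw a b
  /-- these are the only exclusive pairs -/
  rmw_src : ∀ a b, Y.rmw a b → src a = src b
  /-- the executions have the same program order -/
  po_iff : ∀ a ∈ Y.evs, ∀ b ∈ Y.evs,
    (Y.po a b ↔ X.sb (src a) (src b) ∨ Y.rmw a b)
  /-- the executions have the same byte-wise reads-from relation -/
  rbf_iff : ∀ k A B,
    (X.rbf k A B ↔ ∃ a b, src a = A ∧ src b = B ∧ Y.rbf ((X.lab A).block, k) a b)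

/-- The relation on JavaScript events whose linear extensions are witnessing total orders:
sequenced-before, initialisation before overlapping accesses, and ARMv8 observed-before between
release/acquire events. -/
def totBase (X : JS.BaseExecution Addr ι) (Y : Arm.Execution Addr κ) (src : κ → ι) (A B : ι) :
    Prop :=
  X.sb A B ∨ X.initBefore A B ∨ ∃ a b, src a = A ∧ src b = B ∧ Y.obsLA a b

end Compilation

/-! ARMv8 preserves program order between release and acquire events, so successive observations
along a path of `totBase` can be joined in `ob`, and a cycle would violate external visibility. No
edge enters an Init event, so only `sb` and observation edges can occur on a cycle, and `sb` alone
has none. The delicate point is an RMW, which is one event in JavaScript but two in ARMv8: a path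
may enter at its store and leave by an observation from its load. That observation is a from-read,
and atomicity of exclusive pairs moves it to the store (`obs_of_rmw_of_obs`).

Validity compares two kinds of edges. Happens-before from a non-Init event is `sb` or runs through a
release and an acquire, so on ARMv8 events it becomes `po` or `ob` (`po_or_ob_of_hb`). Every
reads-from, from-reads or coherence edge of a byte is a `com` edge: `po` or observed, and never
against `po`. Hence it cannot be opposed by `hb` out of a non-Init target (`not_hb_of_com`), nor by
`tot` between release/acquire events (`not_tot_of_com`). In each pattern with an intervening write
W', W turns out to be coherence-before W', so R from-reads W', although `hb` or `tot` puts W' before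
R. -/

namespace RelaxedMemory

/-! ### Thread orders and linear extensions -/

namespace ThreadOrderOn

variable {α : Type*} {s : Set α} {r : α → α → Prop}

/-- Being in the same thread is transitive. -/
theorem same_thread_trans (h : ThreadOrderOn s r) {a b c : α} (hab : a = b ∨ r a b ∨ r b a)
    (hbc : b = c ∨ r b c ∨ r c b) : a = c ∨ r a c ∨ r c a := by
  rcases hab with rfl | hab | hba
  · exact hbc
  · rcases hbc with rfl | hbc | hcb
    · exact Or.inr (Or.inl hab)
    · exact Or.inr (Or.inl (h.trans _ _ _ hab hbc))
    · exact h.same_thread_of_pred _ _ _ hab hcb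
  · rcases hbc with rfl | hbc | hcb
    · exact Or.inr (Or.inr hba)
    · exact h.same_thread_of_succ _ _ _ hba hbc
    · exact Or.inr (Or.inr (h.trans _ _ _ hcb hba))

end ThreadOrderOn

/-- An acyclic relation on `s` extends to a strict total order on `s`. -/
theorem exists_linearExtension {α : Type*} {s : Set α} {r : α → α → Prop}
    (hmem : ∀ a b, r a b → a ∈ s ∧ b ∈ s) (hr : Acyclic r) :
    ∃ tot : α → α → Prop, LinearExtension s r tot := by
  have : IsPartialOrder α (Relation.ReflTransGen r) :=
    { refl := fun _ => Relation.ReflTransGen.refl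
      trans := fun _ _ _ => Relation.ReflTransGen.trans
      antisymm := fun a b hab hba => by
        rcases Relation.reflTransGen_iff_eq_or_transGen.1 hab with h | h
        · exact h.symm
        · exact (hr a (h.trans_left hba)).elim }
  obtain ⟨t, ht, hle⟩ := extend_partialOrder (Relation.ReflTransGen r)
  -- Szpilrajn gives a reflexive linear order on the whole type; its strict part is cut down to `s`.
  refine ⟨fun a b => a ∈ s ∧ b ∈ s ∧ a ≠ b ∧ t a b, ⟨?_, ?_, ?_, ?_⟩, ?_⟩
  · exact fun a b h => ⟨h.1, h.2.1⟩
  · exact fun a h => h.2.2.1 rfl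
  · rintro a b c ⟨ha, hb, hne, hab⟩ ⟨-, hc, -, hbc⟩
    refine ⟨ha, hc, ?_, ht.trans _ _ _ hab hbc⟩
    rintro rfl
    exact hne (ht.antisymm _ _ hab hbc)
  · intro a ha b hb hne
    rcases ht.total a b with h | h
    · exact Or.inl ⟨ha, hb, hne, h⟩
    · exact Or.inr ⟨hb, ha, hne.symm, h⟩
  · intro a b h
    refine ⟨(hmem a b h).1, (hmem a b h).2, ?_, hle _ _ (Relation.ReflTransGen.single h)⟩
    rintro rfl
    exact hr a (Relation.TransGen.single h)

end RelaxedMemory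

/-! ### ARMv8: coherence against program order and observation -/

namespace Arm

open RelaxedMemory

namespace Event

variable {Addr : Type*} {e : Event Addr}

theorem isWrite_of_mem_rangeW {l : Addr × ℕ} (h : l ∈ e.rangeW) : e.IsWrite := by
  cases e <;> simp_all [rangeW, IsWrite]

theorem isRead_of_mem_rangeR {l : Addr × ℕ} (h : l ∈ e.rangeR) : e.IsRead := by
  cases e <;> simp_all [rangeR, IsRead]

theorem not_isWrite_of_isRead (h : e.IsRead) : ¬ e.IsWrite := by
  cases e <;> simp_all [IsRead, IsWrite]

theorem isWrite_of_isL (h : e.IsL) : e.IsWrite := by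
  cases e <;> simp_all [IsL, IsWrite]

theorem isRead_of_isA (h : e.IsA) : e.IsRead := by
  cases e <;> simp_all [IsA, IsRead]

end Event

namespace Execution

variable {Addr κ : Type*} {Y : Execution Addr κ}

theorem WellFormed.int_trans (hY : Y.WellFormed) {a b c : κ} (hab : Y.int a b)
    (hbc : Y.int b c) : Y.int a c :=
  hY.po_order.same_thread_trans hab hbc

theorem WellFormed.po_mem (hY : Y.WellFormed) {a b : κ} (h : Y.po a b) :
    a ∈ Y.evs ∧ b ∈ Y.evs :=
  ⟨(hY.po_order.mem _ _ h).1.1, (hY.po_order.mem _ _ h).2.1⟩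

theorem WellFormed.frb_mem (hY : Y.WellFormed) {l : Addr × ℕ} {a b : κ} (h : Y.frb l a b) :
    a ∈ Y.evs ∧ b ∈ Y.evs ∧ l ∈ (Y.lab a).rangeR ∧ l ∈ (Y.lab b).rangeW := by
  obtain ⟨c, hca, hcb⟩ := h
  obtain ⟨-, ha, -, hla, -⟩ := hY.rbf_wf _ _ _ hca
  obtain ⟨-, hb, hlb⟩ := (hY.cob_order l).mem _ _ hcb
  exact ⟨ha, hb, hla, hlb⟩

theorem WellFormed.obs_mem (hY : Y.WellFormed) {a b : κ} (h : Y.obs a b) :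
    a ∈ Y.evs ∧ b ∈ Y.evs := by
  rcases h with ⟨⟨l, h⟩, -⟩ | ⟨⟨l, h⟩, -⟩ | ⟨⟨l, h⟩, -⟩
  · exact ⟨(hY.rbf_wf _ _ _ h).1, (hY.rbf_wf _ _ _ h).2.1⟩
  · exact ⟨(hY.frb_mem h).1, (hY.frb_mem h).2.1⟩
  · exact ⟨((hY.cob_order l).mem _ _ h).1.1, ((hY.cob_order l).mem _ _ h).2.1⟩

theorem obs.ob {a b : κ} (h : Y.obs a b) : Y.ob a b := .single (.inl h)

theorem aob.ob {a b : κ} (h : Y.aob a b) : Y.ob a b := .single (.inr (.inr (.inl h)))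

theorem bob.ob {a b : κ} (h : Y.bob a b) : Y.ob a b := .single (.inr (.inr (.inr h)))

/-- Release and acquire events. -/
def IsLA (Y : Execution Addr κ) (a : κ) : Prop := (Y.lab a).IsL ∨ (Y.lab a).IsA

/-- Program order between release and acquire events is preserved. -/
theorem ob_of_po {a b : κ} (ha : Y.IsLA a) (hb : Y.IsLA b) (h : Y.po a b) : Y.ob a b := by
  rcases ha with ha | ha
  · rcases hb with hb | hb
    · exact (bob.release h hb).ob
    · exact (bob.release_acquire ha h hb).ob
  · exact (bob.acquire (.inl ha) h).ob

/-- `a` precedes `b` in the coherence of some byte, and so `b` does not precede `a` in program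
order. -/
def com (Y : Execution Addr κ) (a b : κ) : Prop := (Y.po a b ∨ Y.obs a b) ∧ ¬ Y.po b a

section Coherence

variable (hY : Y.WellFormed) (hV : Y.Valid) {l : Addr × ℕ} {a b : κ}
include hY hV

/-- A reverse `po` edge would close a two-edge cycle in internal visibility at `l`. What remains is
`po` within a thread and `obs` across threads. The next two lemmas follow the same pattern. -/
theorem com_of_rbf (h : Y.rbf l a b) : Y.com a b := by
  obtain ⟨-, -, hla, hlb, -⟩ := hY.rbf_wf _ _ _ h
  have hn : ¬ Y.po b a := fun hpo => hV.internal l a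
    (.tail (.single (.inr (.inr (.inr h)))) (.inl ⟨hpo, .inl hlb, .inr hla⟩))
  refine ⟨?_, hn⟩
  by_cases hi : Y.int a b
  · rcases hi with rfl | hi | hi
    · exact (Event.not_isWrite_of_isRead (Event.isRead_of_mem_rangeR hlb)
        (Event.isWrite_of_mem_rangeW hla)).elim
    · exact .inl hi
    · exact (hn hi).elim
  · exact .inr (.inl ⟨⟨l, h⟩, hi⟩)

theorem com_of_frb (h : Y.frb l a b) : Y.com a b := by
  obtain ⟨-, -, hla, hlb⟩ := hY.frb_mem h
  have hn : ¬ Y.po b a := fun hpo => hV.internal l a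
    (.tail (.single (.inr (.inl h))) (.inl ⟨hpo, .inr hlb, .inl hla⟩))
  refine ⟨?_, hn⟩
  by_cases hi : Y.int a b
  · rcases hi with rfl | hi | hi
    · exact (Event.not_isWrite_of_isRead (Event.isRead_of_mem_rangeR hla)
        (Event.isWrite_of_mem_rangeW hlb)).elim
    · exact .inl hi
    · exact (hn hi).elim
  · exact .inr (.inr (.inl ⟨⟨l, h⟩, hi⟩))

theorem com_of_cob (h : Y.cob l a b) : Y.com a b := by
  obtain ⟨⟨-, hla⟩, -, hlb⟩ := (hY.cob_order l).mem _ _ h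
  have hn : ¬ Y.po b a := fun hpo => hV.internal l a
    (.tail (.single (.inr (.inr (.inl h)))) (.inl ⟨hpo, .inr hlb, .inr hla⟩))
  refine ⟨?_, hn⟩
  by_cases hi : Y.int a b
  · rcases hi with rfl | hi | hi
    · exact ((hY.cob_order l).irrefl _ h).elim
    · exact .inl hi
    · exact (hn hi).elim
  · exact .inr (.inr (.inr ⟨⟨l, h⟩, hi⟩))

omit hY in
-- If neither side is `po`, both are `obs` and form an `ob` cycle. As `com` forgets the byte, the
-- two edges may come from different bytes; this is what handles mixed sizes.
theorem com_asymm (hab : Y.com a b) (hba : Y.com b a) : False := by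
  rcases hab with ⟨h | h, hn⟩
  · exact hba.2 h
  · rcases hba with ⟨h' | h', -⟩
    · exact hn h'
    · exact hV.external a (h.ob.trans h'.ob)

/-- A write that is observed after the load of an exclusive pair is observed after its store. -/
theorem obs_of_rmw_of_obs {c : κ} (hr : Y.rmw a b) (h : Y.obs a c) :
    Y.obs b c := by
  obtain ⟨hpo, ha, -, hb, -, hrange, -⟩ := hY.rmw_wf _ _ hr
  have hab : Y.int a b := .inr (.inl hpo)
  have hba : Y.int b a := .inr (.inr hpo)
  rcases h with ⟨⟨l, h⟩, -⟩ | ⟨⟨l, h⟩, hi⟩ | ⟨⟨l, h⟩, -⟩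
  · exact (Event.not_isWrite_of_isRead ha
      (Event.isWrite_of_mem_rangeW (hY.rbf_wf _ _ _ h).2.2.1)).elim
  · obtain ⟨-, hcm, hla, hlc⟩ := hY.frb_mem h
    have hbc : ¬ Y.int b c := fun h' => hi (hY.int_trans hab h')
    have hcb : ¬ Y.int c b := fun h' => hbc (by
      rcases h' with h' | h' | h'
      · exact .inl h'.symm
      · exact .inr (.inr h')
      · exact .inr (.inl h'))
    -- The store `b` covers the byte `l` read by `a`, so coherence compares it with `c`; were `c`
    -- first, it would intervene between the load and the store of the pair.
    rcases (hY.cob_order l).total b ⟨(hY.po_mem hpo).2, hrange ▸ hla⟩ c ⟨hcm, hlc⟩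
      (fun h' => hbc (.inl h')) with h' | h'
    · exact .inr (.inr ⟨⟨l, h'⟩, hbc⟩)
    · exact (hV.atomic a b hr ⟨c, ⟨⟨l, h⟩, hi⟩, ⟨l, h'⟩, hcb⟩).elim
  · exact (Event.not_isWrite_of_isRead ha
      (Event.isWrite_of_mem_rangeW ((hY.cob_order l).mem _ _ h).1.2)).elim

end Coherence

end Execution

end Arm

/-! ### JavaScript: nonempty ranges and targets of happens-before -/

namespace JS.BaseExecution

variable {Addr ι : Type*} {X : BaseExecution Addr ι}

theorem rangeR_ne {E : Event Addr} {l : Addr × ℕ} (h : l ∈ E.rangeR) : E.reads ≠ [] := by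
  rintro h0
  simp [Event.rangeR, RelaxedMemory.byteRange, h0] at h
  omega

theorem rangeW_ne {E : Event Addr} {l : Addr × ℕ} (h : l ∈ E.rangeW) : E.writes ≠ [] := by
  rintro h0
  simp [Event.rangeW, RelaxedMemory.byteRange, h0] at h
  omega

theorem not_init_of_hb (hX : X.ThreadLocalWF) (hsync : X.NoAdditionalSync) {A B : ι}
    (h : X.hb A B) : (X.lab B).ord ≠ Mode.init := by
  have key : ∀ {C : ι}, (X.sb C B ∨ X.sw C B ∨ X.initBefore C B) →
      (X.lab B).ord ≠ Mode.init := by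
    rintro C (h | (h | h) | h)
    · exact (hX.sb_order.mem _ _ h).2.2
    · simp [h.2.2.2]
    · exact (hsync _ _ h).elim
    · exact h.2.2.2.1
  cases h with
  | single h => exact key h
  | tail _ h => exact key h

end JS.BaseExecution

namespace Compilation.CompilesTo

open RelaxedMemory Arm.Execution

variable {Addr ι κ : Type*} {X : JS.BaseExecution Addr ι} {Y : Arm.Execution Addr κ} {src : κ → ι}

/-! ### Correspondence of events, program order and reads-from -/

section Events

variable (hY : Y.WellFormed) (hcomp : CompilesTo X Y src)
include hcomp

theorem lab_cases {a : κ} (ha : a ∈ Y.evs) :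
    (∃ e, Y.lab a = readEvent (X.lab (src a)) e) ∨
      ∃ e, Y.lab a = writeEvent (X.lab (src a)) e := by
  have hA := hcomp.src_mem a ha
  have hmem : a ∈ {c | c ∈ Y.evs ∧ src c = src a} := ⟨ha, rfl⟩
  by_cases hw : (X.lab (src a)).writes = []
  · obtain ⟨b, hb, hl⟩ := hcomp.load _ hA hw
    rw [hb] at hmem
    obtain rfl : a = b := hmem
    exact .inl ⟨_, hl⟩
  · by_cases hr : (X.lab (src a)).reads = []
    · obtain ⟨b, hb, hl⟩ := hcomp.store _ hA hr
      rw [hb] at hmem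
      obtain rfl : a = b := hmem
      exact .inr ⟨_, hl⟩
    · obtain ⟨b, c, hb, hl, hl', -⟩ := hcomp.rmw _ hA ⟨hr, hw⟩
      rw [hb] at hmem
      rcases hmem with h | h
      · rw [← h] at hl
        exact .inl ⟨_, hl⟩
      · rw [← (show a = c from h)] at hl'
        exact .inr ⟨_, hl'⟩

theorem eq_or_rmw {a b : κ} (ha : a ∈ Y.evs) (hb : b ∈ Y.evs) (h : src a = src b) :
    a = b ∨ Y.rmw a b ∨ Y.rmw b a := by
  have hA := hcomp.src_mem a ha
  have hma : a ∈ {c | c ∈ Y.evs ∧ src c = src a} := ⟨ha, rfl⟩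
  have hmb : b ∈ {c | c ∈ Y.evs ∧ src c = src a} := ⟨hb, h.symm⟩
  by_cases hw : (X.lab (src a)).writes = []
  · obtain ⟨c, hc, -⟩ := hcomp.load _ hA hw
    rw [hc] at hma hmb
    exact .inl ((show a = c from hma).trans (show b = c from hmb).symm)
  · by_cases hr : (X.lab (src a)).reads = []
    · obtain ⟨c, hc, -⟩ := hcomp.store _ hA hr
      rw [hc] at hma hmb
      exact .inl ((show a = c from hma).trans (show b = c from hmb).symm)
    · obtain ⟨c, d, hc, -, -, hrmw⟩ := hcomp.rmw _ hA ⟨hr, hw⟩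
      rw [hc] at hma hmb
      rcases hma with rfl | hma <;> rcases hmb with rfl | hmb
      · exact .inl rfl
      · exact .inr (.inl ((show b = d from hmb) ▸ hrmw))
      · exact .inr (.inr ((show a = d from hma) ▸ hrmw))
      · exact .inl ((show a = d from hma).trans (show b = d from hmb).symm)

theorem exists_load {A : ι} (hA : A ∈ X.evs) (hr : (X.lab A).reads ≠ []) :
    ∃ a ∈ Y.evs, src a = A ∧ ∃ e, Y.lab a = readEvent (X.lab A) e := by
  by_cases hw : (X.lab A).writes = []
  · obtain ⟨a, ha, hl⟩ := hcomp.load _ hA hw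
    have : a ∈ {c | c ∈ Y.evs ∧ src c = A} := ha ▸ rfl
    exact ⟨a, this.1, this.2, _, hl⟩
  · obtain ⟨a, b, ha, hl, -⟩ := hcomp.rmw _ hA ⟨hr, hw⟩
    have : a ∈ {c | c ∈ Y.evs ∧ src c = A} := ha ▸ .inl rfl
    exact ⟨a, this.1, this.2, _, hl⟩

theorem exists_store {A : ι} (hA : A ∈ X.evs) (hw : (X.lab A).writes ≠ []) :
    ∃ a ∈ Y.evs, src a = A ∧ ∃ e, Y.lab a = writeEvent (X.lab A) e := by
  by_cases hr : (X.lab A).reads = []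
  · obtain ⟨a, ha, hl⟩ := hcomp.store _ hA hr
    have : a ∈ {c | c ∈ Y.evs ∧ src c = A} := ha ▸ rfl
    exact ⟨a, this.1, this.2, _, hl⟩
  · obtain ⟨a, b, ha, -, hl, -⟩ := hcomp.rmw _ hA ⟨hr, hw⟩
    have : b ∈ {c | c ∈ Y.evs ∧ src c = A} := ha ▸ .inr rfl
    exact ⟨b, this.1, this.2, _, hl⟩

theorem lab_of_isRead {a : κ} (ha : a ∈ Y.evs) (h : (Y.lab a).IsRead) :
    ∃ e, Y.lab a = readEvent (X.lab (src a)) e := by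
  rcases lab_cases hcomp ha with h' | ⟨e, h'⟩
  · exact h'
  · rw [h'] at h
    exact h.elim

theorem lab_of_isWrite {a : κ} (ha : a ∈ Y.evs) (h : (Y.lab a).IsWrite) :
    ∃ e, Y.lab a = writeEvent (X.lab (src a)) e := by
  rcases lab_cases hcomp ha with ⟨e, h'⟩ | h'
  · rw [h'] at h
    exact h.elim
  · exact h'

theorem isInit_iff {a : κ} (ha : a ∈ Y.evs) (h : (Y.lab a).IsWrite) :
    (Y.lab a).IsInit ↔ (X.lab (src a)).ord = JS.Mode.init := by
  obtain ⟨e, he⟩ := lab_of_isWrite hcomp ha h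
  rw [he, writeEvent]
  cases (X.lab (src a)).ord <;> simp [writeOrd, Arm.Event.IsInit]

theorem isLA_of_seqCst {a : κ} (ha : a ∈ Y.evs) (h : (X.lab (src a)).ord = JS.Mode.seqCst) :
    Y.IsLA a := by
  rcases lab_cases hcomp ha with ⟨e, h'⟩ | ⟨e, h'⟩
  · right
    rw [h', readEvent, h]
    trivial
  · left
    rw [h', writeEvent, h]
    trivial

theorem rangeW_eq {a : κ} (ha : a ∈ Y.evs) (h : (Y.lab a).IsWrite) :
    (Y.lab a).rangeW = (X.lab (src a)).rangeW := by
  obtain ⟨e, he⟩ := lab_of_isWrite hcomp ha h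
  rw [he]
  rfl

theorem rangeR_eq {a : κ} (ha : a ∈ Y.evs) (h : (Y.lab a).IsRead) :
    (Y.lab a).rangeR = (X.lab (src a)).rangeR := by
  obtain ⟨e, he⟩ := lab_of_isRead hcomp ha h
  rw [he]
  rfl

/-- The store that implements an event writing `l`. -/
theorem exists_store_of_mem {A : ι} (hA : A ∈ X.evs) {l : Addr × ℕ} (hl : l ∈ (X.lab A).rangeW) :
    ∃ a ∈ Y.evs, src a = A ∧ l ∈ (Y.lab a).rangeW := by
  obtain ⟨a, ha, rfl, e, he⟩ := exists_store hcomp hA (JS.BaseExecution.rangeW_ne hl)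
  refine ⟨a, ha, rfl, ?_⟩
  rw [he]
  exact hl

theorem exists_load_of_mem {A : ι} (hA : A ∈ X.evs) {l : Addr × ℕ} (hl : l ∈ (X.lab A).rangeR) :
    ∃ a ∈ Y.evs, src a = A ∧ l ∈ (Y.lab a).rangeR := by
  obtain ⟨a, ha, rfl, e, he⟩ := exists_load hcomp hA (JS.BaseExecution.rangeR_ne hl)
  refine ⟨a, ha, rfl, ?_⟩
  rw [he]
  exact hl

include hY

theorem eq_of_isRead {a b : κ} (ha : a ∈ Y.evs) (hb : b ∈ Y.evs) (h : src a = src b)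
    (hra : (Y.lab a).IsRead) (hrb : (Y.lab b).IsRead) : a = b := by
  rcases eq_or_rmw hcomp ha hb h with h | h | h
  · exact h
  · exact (Arm.Event.not_isWrite_of_isRead hrb (hY.rmw_wf _ _ h).2.2.2.1).elim
  · exact (Arm.Event.not_isWrite_of_isRead hra (hY.rmw_wf _ _ h).2.2.2.1).elim

theorem eq_or_rmw_of_isWrite {a b : κ} (ha : a ∈ Y.evs) (hb : b ∈ Y.evs) (h : src a = src b)
    (hwb : (Y.lab b).IsWrite) : a = b ∨ Y.rmw a b := by
  rcases eq_or_rmw hcomp ha hb h with h | h | h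
  · exact .inl h
  · exact .inr h
  · exact (Arm.Event.not_isWrite_of_isRead (hY.rmw_wf _ _ h).2.1 hwb).elim

theorem eq_or_rmw_of_isRead {a b : κ} (ha : a ∈ Y.evs) (hb : b ∈ Y.evs) (h : src a = src b)
    (hra : (Y.lab a).IsRead) : a = b ∨ Y.rmw a b := by
  rcases eq_or_rmw hcomp ha hb h with h | h | h
  · exact .inl h
  · exact .inr h
  · exact (Arm.Event.not_isWrite_of_isRead hra (hY.rmw_wf _ _ h).2.2.2.1).elim

theorem sb_or_eq_of_po {a b : κ} (h : Y.po a b) : X.sb (src a) (src b) ∨ src a = src b := by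
  obtain ⟨ha, hb⟩ := hY.po_mem h
  rcases (hcomp.po_iff a ha b hb).1 h with h | h
  · exact .inl h
  · exact .inr (hcomp.rmw_src _ _ h)

omit hY in
theorem po_of_sb {a b : κ} (ha : a ∈ Y.evs) (hb : b ∈ Y.evs) (h : X.sb (src a) (src b)) :
    Y.po a b :=
  (hcomp.po_iff a ha b hb).2 (.inl h)

theorem rbfWF (hV : Y.Valid) : X.RbfWF := by
  have key : ∀ {k A B}, X.rbf k A B → ∃ a b, src a = A ∧ src b = B ∧ a ∈ Y.evs ∧ b ∈ Y.evs ∧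
      Y.rbf ((X.lab A).block, k) a b ∧ (∃ e, Y.lab a = writeEvent (X.lab A) e) ∧
      (∃ e, Y.lab b = readEvent (X.lab B) e) ∧ ((X.lab A).block, k) ∈ (X.lab A).rangeW ∧
      ((X.lab A).block, k) ∈ (X.lab B).rangeR := by
    intro k A B h
    obtain ⟨a, b, rfl, rfl, hab⟩ := (hcomp.rbf_iff _ _ _).1 h
    obtain ⟨ha, hb, hla, hlb, -⟩ := hY.rbf_wf _ _ _ hab
    have hw := Arm.Event.isWrite_of_mem_rangeW hla
    have hr := Arm.Event.isRead_of_mem_rangeR hlb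
    rw [rangeW_eq hcomp ha hw] at hla
    rw [rangeR_eq hcomp hb hr] at hlb
    exact ⟨a, b, rfl, rfl, ha, hb, hab, lab_of_isWrite hcomp ha hw,
      lab_of_isRead hcomp hb hr, hla, hlb⟩
  refine ⟨?_, ?_, ?_, ?_, ?_, ?_, ?_⟩
  · intro k A B h
    obtain ⟨a, b, rfl, rfl, ha, hb, -⟩ := key h
    exact ⟨hcomp.src_mem a ha, hcomp.src_mem b hb⟩
  · rintro k A B h rfl
    obtain ⟨a, b, hA, hB, ha, hb, h, ⟨e, he⟩, ⟨e', he'⟩, -⟩ := key h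
    have hw : (Y.lab a).IsWrite := by rw [he]; trivial
    have hr : (Y.lab b).IsRead := by rw [he']; trivial
    rcases eq_or_rmw_of_isWrite hY hcomp hb ha (hB.trans hA.symm) hw with h' | h'
    · subst h'
      exact Arm.Event.not_isWrite_of_isRead hr hw
    -- An RMW cannot read from itself: its load is `po`-before its store.
    · exact (com_of_rbf hY hV h).2 (hY.rmw_wf _ _ h').1
  · intro k A B h
    obtain ⟨a, b, -, -, -, -, -, -, -, -, h⟩ := key h
    exact h.1
  · intro k A B h
    obtain ⟨a, b, -, -, -, -, -, -, -, h, -⟩ := key h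
    exact h
  · intro k A B h
    obtain ⟨a, b, -, -, -, -, -, -, -, -, h⟩ := key h
    exact ⟨rfl, h.2⟩
  · intro k A B h
    obtain ⟨a, b, -, -, -, -, h, ⟨e, he⟩, ⟨e', he'⟩, -⟩ := key h
    have := (hY.rbf_wf _ _ _ h).2.2.2.2
    rw [he, he'] at this
    exact this
  · intro B hB k hk
    obtain ⟨b, hb, rfl, hlb⟩ := exists_load_of_mem hcomp hB hk
    obtain ⟨a, ha, hua⟩ := hY.rbf_justified b hb _ hlb
    obtain ⟨hma, -, hla, -⟩ := hY.rbf_wf _ _ _ ha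
    rw [rangeW_eq hcomp hma (Arm.Event.isWrite_of_mem_rangeW hla)] at hla
    have hblk : (X.lab (src b)).block = (X.lab (src a)).block := hla.1
    refine ⟨src a, (hcomp.rbf_iff _ _ _).2 ⟨a, b, rfl, rfl, hblk ▸ ha⟩, ?_⟩
    -- Two loads with the same source coincide, so uniqueness passes from the ARMv8 reads-from to
    -- its image.
    intro A' hA'
    obtain ⟨a', b', rfl, hB', -, hb', h', -, ⟨e', he'⟩, -, hl'⟩ := key hA'
    have hr : (Y.lab b').IsRead := by rw [he']; trivial
    obtain rfl := eq_of_isRead hY hcomp hb' hb hB' hr (Arm.Event.isRead_of_mem_rangeR hlb)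
    have hblk' : (X.lab (src a')).block = (X.lab (src b')).block := hl'.1
    rw [hblk'] at h'
    rw [hua a' h']

end Events

/-! ### From happens-before and `totBase` to ordered-before -/

section Order

variable (hX : X.ThreadLocalWF) (hY : Y.WellFormed) (hcomp : CompilesTo X Y src) (hV : Y.Valid)
include hX hY hcomp hV

omit hX hY hV in
theorem exists_rbf_of_rf {W R : ι} (h : X.rf W R) :
    ∃ l w r, src w = W ∧ src r = R ∧ Y.rbf l w r := by
  obtain ⟨k, h⟩ := h
  obtain ⟨w, r, hw, hr, h⟩ := (hcomp.rbf_iff _ _ _).1 h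
  exact ⟨_, w, r, hw, hr, h⟩

omit hX in
/-- Synchronization is program order or observation of a release by an acquire. -/
theorem sb_or_obs_of_sw (hsync : X.NoAdditionalSync) {A B : ι} (h : X.sw A B) :
    X.sb A B ∨ ∃ a b, src a = A ∧ src b = B ∧ (Y.lab a).IsL ∧ (Y.lab b).IsA ∧ Y.obs a b := by
  rcases h with ⟨hrf, -, hA, hB⟩ | h
  · obtain ⟨k, hk⟩ := hrf
    have hne := (rbfWF hY hcomp hV).ne _ _ _ hk
    obtain ⟨l, a, b, rfl, rfl, h⟩ := exists_rbf_of_rf hcomp ⟨k, hk⟩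
    obtain ⟨ha, hb, hla, hlb, -⟩ := hY.rbf_wf _ _ _ h
    rcases (com_of_rbf hY hV h).1 with h' | h'
    · exact .inl ((sb_or_eq_of_po hY hcomp h').resolve_right hne)
    · refine .inr ⟨a, b, rfl, rfl, ?_, ?_, h'⟩
      · exact (isLA_of_seqCst hcomp ha hA).resolve_right fun h'' =>
          Arm.Event.not_isWrite_of_isRead (Arm.Event.isRead_of_isA h'')
            (Arm.Event.isWrite_of_mem_rangeW hla)
      · exact (isLA_of_seqCst hcomp hb hB).resolve_left fun h'' =>
          Arm.Event.not_isWrite_of_isRead (Arm.Event.isRead_of_mem_rangeR hlb)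
            (Arm.Event.isWrite_of_isL h'')
  · exact (hsync _ _ h).elim

/-- Happens-before is program order or passes through a release and an acquire. -/
theorem sb_or_ob_of_hb (hsync : X.NoAdditionalSync) {A B : ι}
    (hA : (X.lab A).ord ≠ JS.Mode.init) (h : X.hb A B) :
    X.sb A B ∨ ∃ s r, s ∈ Y.evs ∧ r ∈ Y.evs ∧ (A = src s ∨ X.sb A (src s)) ∧ (Y.lab s).IsL ∧
      Y.ob s r ∧ (Y.lab r).IsA ∧ (src r = B ∨ X.sb (src r) B) := by
  have step : ∀ {C D : ι}, (X.lab C).ord ≠ JS.Mode.init →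
      (X.sb C D ∨ X.sw C D ∨ X.initBefore C D) → X.sb C D ∨
        ∃ a b, src a = C ∧ src b = D ∧ (Y.lab a).IsL ∧ (Y.lab b).IsA ∧ Y.obs a b := by
    rintro C D hC (h | h | h)
    · exact .inl h
    · exact sb_or_obs_of_sw hY hcomp hV hsync h
    · exact (hC h.2.2.1).elim
  induction h with
  | single h =>
    rcases step hA h with h | ⟨s, r, rfl, rfl, hs, hr, h⟩
    · exact .inl h
    · exact .inr ⟨s, r, (hY.obs_mem h).1, (hY.obs_mem h).2, .inl rfl, hs, h.ob, hr, .inl rfl⟩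
  | @tail B C hAB hBC ih =>
    have hB := JS.BaseExecution.not_init_of_hb hX hsync hAB
    rcases step hB hBC with h | ⟨s, r, rfl, rfl, hs, hr, h⟩
    · rcases ih with ih | ⟨s, r, hms, hmr, hAs, hs, hsr, hr, hrB⟩
      · exact .inl (hX.sb_order.trans _ _ _ ih h)
      · refine .inr ⟨s, r, hms, hmr, hAs, hs, hsr, hr, .inr ?_⟩
        rcases hrB with rfl | hrB
        · exact h
        · exact hX.sb_order.trans _ _ _ hrB h
    · obtain ⟨hms, hmr⟩ := hY.obs_mem h
      rcases ih with ih | ⟨s', r', hms', hmr', hAs, hs', hsr, hr', hrB⟩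
      · exact .inr ⟨s, r, hms, hmr, .inr ih, hs, h.ob, hr, .inl rfl⟩
      · refine .inr ⟨s', r, hms', hmr, hAs, hs', (hsr.trans ?_).trans h.ob, hr, .inl rfl⟩
        -- The acquire `r'` and the next release `s` are either the two halves of one RMW, ordered
        -- by `aob`, or in program order, which an acquire preserves.
        rcases hrB with hrB | hrB
        · rcases eq_or_rmw_of_isWrite hY hcomp hmr' hms hrB (Arm.Event.isWrite_of_isL hs)
            with rfl | h'
          · exact (Arm.Event.not_isWrite_of_isRead (Arm.Event.isRead_of_isA hr')
              (Arm.Event.isWrite_of_isL hs)).elim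
          · exact (aob.rmw h').ob
        · exact (bob.acquire (.inl hr') (po_of_sb hcomp hmr' hms hrB)).ob

/-- Program order into the first release and out of the last acquire is barrier-ordered, so the `ob`
path extends to arbitrary endpoints, even plain ones. If an endpoint is the other half of an RMW,
`aob` supplies the missing edge. -/
theorem po_or_ob_of_hb (hsync : X.NoAdditionalSync) {a b : κ} (ha : a ∈ Y.evs) (hb : b ∈ Y.evs)
    (hA : (X.lab (src a)).ord ≠ JS.Mode.init) (h : X.hb (src a) (src b)) :
    Y.po a b ∨ Y.ob a b := by
  rcases sb_or_ob_of_hb hX hY hcomp hV hsync hA h with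
    h | ⟨s, r, hms, hmr, hAs, hs, hsr, hr, hrB⟩
  · exact .inl (po_of_sb hcomp ha hb h)
  · have hsb : Y.ob s b := by
      rcases hrB with hrB | hrB
      · rcases eq_or_rmw_of_isRead hY hcomp hmr hb hrB (Arm.Event.isRead_of_isA hr)
          with rfl | h'
        · exact hsr
        · exact hsr.trans (aob.rmw h').ob
      · exact hsr.trans (bob.acquire (.inl hr) (po_of_sb hcomp hmr hb hrB)).ob
    right
    rcases hAs with hAs | hAs
    · rcases eq_or_rmw_of_isWrite hY hcomp ha hms hAs (Arm.Event.isWrite_of_isL hs)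
        with rfl | h'
      · exact hsb
      · exact (aob.rmw h').ob.trans hsb
    · exact (bob.release (po_of_sb hcomp ha hms hAs) hs).ob.trans hsb

omit hV in
theorem totBase_mem {A B : ι} (h : totBase X Y src A B) :
    A ∈ X.evs ∧ B ∈ X.evs := by
  rcases h with h | h | ⟨a, b, rfl, rfl, h⟩
  · exact ⟨(hX.sb_order.mem _ _ h).1.1, (hX.sb_order.mem _ _ h).2.1⟩
  · exact ⟨h.1, h.2.1⟩
  · exact ⟨hcomp.src_mem _ (hY.obs_mem h.1).1, hcomp.src_mem _ (hY.obs_mem h.1).2⟩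

omit hX in
/-- An ordered-before path that ends in the thread of its successor extends along it: for an
exclusive pair, the observation may be moved from the load to the store. -/
theorem ob_of_eq_or_sb_of_obsLA {a b c : κ} (ha : a ∈ Y.evs) (hLA : Y.IsLA a)
    (h : src a = src b ∨ X.sb (src a) (src b)) (hbc : Y.obsLA b c) : Y.ob a c := by
  obtain ⟨hobs, hb, -⟩ := hbc
  have hmb := (hY.obs_mem hobs).1
  rcases h with h | h
  · rcases eq_or_rmw hcomp ha hmb h with rfl | h | h
    · exact hobs.ob
    · exact (aob.rmw h).ob.trans hobs.ob
    · exact (obs_of_rmw_of_obs hY hV h hobs).ob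
  · exact (ob_of_po hLA hb (po_of_sb hcomp ha hmb h)).trans hobs.ob

/-- A cycle avoids Init events. If it is not made of `sb` alone, it contains an observation, and
joining consecutive observations gives an `ob` cycle. -/
theorem totBase_acyclic : Acyclic (totBase X Y src) := by
  have ninit : ∀ {A B : ι}, totBase X Y src A B → (X.lab B).ord ≠ JS.Mode.init := by
    rintro A B (h | h | ⟨a, b, rfl, rfl, h⟩)
    · exact (hX.sb_order.mem _ _ h).2.2
    · exact h.2.2.2.1
    · intro h0
      have hb := (hY.obs_mem h.1).2
      rcases lab_cases hcomp hb with ⟨e, he⟩ | ⟨e, he⟩ <;>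
        · have := h.2.2
          rw [he] at this
          simp [readEvent, writeEvent, h0, readOrd, writeOrd, Arm.Event.IsL, Arm.Event.IsA] at this
  -- The first observation `a`, `c` is kept apart from the later `ob` path: joining the end of a
  -- cycle to its start may require moving that observation from the load of an RMW to its store,
  -- which a bare `ob` path does not allow.
  have path : ∀ {A B : ι}, (X.lab A).ord ≠ JS.Mode.init →
      Relation.TransGen (totBase X Y src) A B → X.sb A B ∨
        ∃ a c b, b ∈ Y.evs ∧ (A = src a ∨ X.sb A (src a)) ∧ Y.obsLA a c ∧ (c = b ∨ Y.ob c b) ∧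
          Y.IsLA b ∧ (src b = B ∨ X.sb (src b) B) := by
    intro A B hA h
    induction h with
    | single h =>
      rcases h with h | h | ⟨a, b, rfl, rfl, h⟩
      · exact .inl h
      · exact (hA h.2.2.1).elim
      · exact .inr ⟨a, b, b, (hY.obs_mem h.1).2, .inl rfl, h, .inl rfl, h.2.2, .inl rfl⟩
    | @tail B C hAB hBC ih =>
      have hB : (X.lab B).ord ≠ JS.Mode.init := by
        cases hAB with
        | single h => exact ninit h
        | tail _ h => exact ninit h
      rcases hBC with h | h | ⟨a, b, rfl, rfl, h⟩
      · rcases ih with ih | ⟨a, c, b, hb, hAa, hac, hcb, hLA, hbB⟩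
        · exact .inl (hX.sb_order.trans _ _ _ ih h)
        · refine .inr ⟨a, c, b, hb, hAa, hac, hcb, hLA, .inr ?_⟩
          rcases hbB with rfl | hbB
          · exact h
          · exact hX.sb_order.trans _ _ _ hbB h
      · exact (hB h.2.2.1).elim
      · rcases ih with ih | ⟨a', c, b', hb', hAa, hac, hcb, hLA, hbB⟩
        · exact .inr ⟨a, b, b, (hY.obs_mem h.1).2, .inr ih, h, .inl rfl, h.2.2, .inl rfl⟩
        · have hob := ob_of_eq_or_sb_of_obsLA hY hcomp hV hb' hLA hbB h
          refine .inr ⟨a', c, b, (hY.obs_mem h.1).2, hAa, hac, .inr ?_, h.2.2, .inl rfl⟩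
          rcases hcb with rfl | hcb
          · exact hob
          · exact hcb.trans hob
  intro A h
  have hA : (X.lab A).ord ≠ JS.Mode.init := by
    cases h with
    | single h => exact ninit h
    | tail _ h => exact ninit h
  rcases path hA h with h | ⟨a, c, b, hb, hAa, hac, hcb, hLA, hbA⟩
  · exact hX.sb_order.irrefl _ h
  · have hba : src b = src a ∨ X.sb (src b) (src a) := by
      rcases hbA with rfl | hbA
      · exact hAa
      · rcases hAa with rfl | hAa
        · exact .inr hbA
        · exact .inr (hX.sb_order.trans _ _ _ hbA hAa)
    have hob := ob_of_eq_or_sb_of_obsLA hY hcomp hV hb hLA hba hac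
    rcases hcb with rfl | hcb
    · exact hV.external _ hob
    · exact hV.external _ (hob.trans hcb)

end Order

/-! ### Well-formedness and validity for every linear extension -/

section Validity

variable (hX : X.ThreadLocalWF) (hsync : X.NoAdditionalSync) (hY : Y.WellFormed)
  (hcomp : CompilesTo X Y src) (hV : Y.Valid) {tot : ι → ι → Prop}
  (htot : LinearExtension X.evs (totBase X Y src) tot)
include hX hsync hY hcomp hV htot

/-- A synchronization that is not already `sb` is an observation of a release by an acquire, hence
an edge of `totBase`. -/
theorem tot_of_hb {A B : ι} (h : X.hb A B) : tot A B := by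
  have step : ∀ {A B : ι}, (X.sb A B ∨ X.sw A B ∨ X.initBefore A B) → tot A B := by
    rintro A B (h | h | h)
    · exact htot.contains _ _ (.inl h)
    · rcases sb_or_obs_of_sw hY hcomp hV hsync h with h | ⟨a, b, ha, hb, hL, hA, h⟩
      · exact htot.contains _ _ (.inl h)
      · exact htot.contains _ _ (.inr (.inr ⟨a, b, ha, hb, h, .inl hL, .inr hA⟩))
    · exact htot.contains _ _ (.inr (.inl h))
  induction h with
  | single h => exact step h
  | tail _ h ih => exact htot.strictTotal.trans _ _ _ ih (step h)

theorem hb_irrefl (A : ι) : ¬ X.hb A A := fun h =>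
  htot.strictTotal.irrefl A (tot_of_hb hX hsync hY hcomp hV htot h)

/-- If the `com` edge is `po`, its image with the opposing `hb` gives an `hb` loop. If it is `obs`,
the opposing `hb` lifts to `po`, excluded by `com`, or to `ob`, closing a cycle. -/
theorem not_hb_of_com {a b : κ} (ha : a ∈ Y.evs) (hb : b ∈ Y.evs)
    (hB : (X.lab (src b)).ord ≠ JS.Mode.init) (hab : Y.com a b) : ¬ X.hb (src b) (src a) := by
  intro h
  have hirr := hb_irrefl hX hsync hY hcomp hV htot
  rcases hab with ⟨hpo | hobs, hn⟩
  · rcases sb_or_eq_of_po hY hcomp hpo with h' | h'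
    · exact hirr _ (h.tail (.inl h'))
    · exact hirr _ (h' ▸ h)
  · rcases po_or_ob_of_hb hX hY hcomp hV hsync hb ha hB h with h' | h'
    · exact hn h'
    · exact hV.external _ (hobs.ob.trans h')

omit hX hsync hV in
-- Both endpoints must be release or acquire, since only such observations belong to `totBase`.
theorem not_tot_of_com {a b : κ} (ha : Y.IsLA a) (hb : Y.IsLA b) (hab : Y.com a b) :
    ¬ tot (src b) (src a) := by
  intro h
  have hirr := htot.strictTotal.irrefl
  rcases hab with ⟨hpo | hobs, -⟩
  · rcases sb_or_eq_of_po hY hcomp hpo with h' | h'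
    · exact hirr _ (htot.strictTotal.trans _ _ _ h (htot.contains _ _ (.inl h')))
    · exact hirr _ (h' ▸ h)
  · exact hirr _ (htot.strictTotal.trans _ _ _ h
      (htot.contains _ _ (.inr (.inr ⟨a, b, rfl, rfl, hobs, ha, hb⟩))))

/-- Coherence is total on the writes to `l`, and the reverse edge would oppose `hb`. An Init source,
from which `hb` does not lift to `ob`, is first in coherence by `cob_init`. -/
theorem cob_of_hb {l : Addr × ℕ} {a b : κ} (ha : a ∈ Y.evs) (hb : b ∈ Y.evs)
    (hla : l ∈ (Y.lab a).rangeW) (hlb : l ∈ (Y.lab b).rangeW) (h : X.hb (src a) (src b)) :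
    Y.cob l a b := by
  have hB := JS.BaseExecution.not_init_of_hb hX hsync h
  have hwa := Arm.Event.isWrite_of_mem_rangeW hla
  have hwb := Arm.Event.isWrite_of_mem_rangeW hlb
  by_cases hA : (X.lab (src a)).ord = JS.Mode.init
  · exact hY.cob_init l a ha b hb hla hlb ((isInit_iff hcomp ha hwa).2 hA)
      fun h' => hB ((isInit_iff hcomp hb hwb).1 h')
  · refine ((hY.cob_order l).total a ⟨ha, hla⟩ b ⟨hb, hlb⟩ ?_).resolve_right fun h' => ?_
    · rintro rfl
      exact hb_irrefl hX hsync hY hcomp hV htot _ h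
    · exact not_hb_of_com hX hsync hY hcomp hV htot hb ha hA (com_of_cob hY hV h') h

omit hsync in
theorem wellFormed : (X.withTot tot).WellFormed :=
  ⟨hX, rbfWF hY hcomp hV, htot.strictTotal⟩

theorem hbConsistency2 : (X.withTot tot).HBConsistency2 := by
  intro W R hrf h
  obtain ⟨l, w, r, rfl, rfl, hwr⟩ := exists_rbf_of_rf hcomp hrf
  obtain ⟨hw, hr, -, hlr, -⟩ := hY.rbf_wf _ _ _ hwr
  refine not_hb_of_com hX hsync hY hcomp hV htot hw hr (fun h0 => ?_) (com_of_rbf hY hV hwr) h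
  rw [rangeR_eq hcomp hr (Arm.Event.isRead_of_mem_rangeR hlr)] at hlr
  exact JS.BaseExecution.rangeR_ne hlr (hX.init_write _ (hcomp.src_mem r hr) h0)

theorem hbConsistency3 : (X.withTot tot).HBConsistency3 := by
  rintro k W R hrbf ⟨W', hWW', hWR, hk⟩
  have hblk := (rbfWF hY hcomp hV).block_eq _ _ _ hrbf
  obtain ⟨w, r, rfl, rfl, hwr⟩ := (hcomp.rbf_iff _ _ _).1 hrbf
  have hW' : W' ∈ X.evs :=
    (htot.strictTotal.mem _ _ (tot_of_hb hX hsync hY hcomp hV htot hWW')).2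
  obtain ⟨w', hw', rfl, hl'⟩ := exists_store_of_mem hcomp hW' hk
  obtain ⟨hw, hr, hlw, -, -⟩ := hY.rbf_wf _ _ _ hwr
  have hl'' : ((X.lab (src w)).block, k) ∈ (Y.lab w').rangeW := by
    have hb : (X.lab (src w)).block = (X.lab (src r)).block := hblk
    rw [hb]
    exact hl'
  -- Thus `r` from-reads `w'`, against `hb` from `w'` to `r`.
  have hcob := cob_of_hb hX hsync hY hcomp hV htot hw hw' hlw hl'' hWW'
  exact not_hb_of_com hX hsync hY hcomp hV htot hr hw'
    (JS.BaseExecution.not_init_of_hb hX hsync hWW') (com_of_frb hY hV ⟨w, hwr, hcob⟩) hWR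

omit hX htot hsync in
-- Equal ranges make both stores write both bytes `l₁` and `l₂`. Their order must agree on the two
-- bytes, and then the load from-reads the later store although it also reads from it.
theorem tearFreeReads : (X.withTot tot).TearFreeReads := by
  rintro R - -
  rw [Set.encard_le_one_iff]
  rintro W₁ W₂ ⟨hrf₁, -, hW₁⟩ ⟨hrf₂, -, hW₂⟩
  obtain ⟨l₁, w₁, r, rfl, rfl, h₁⟩ := exists_rbf_of_rf hcomp hrf₁
  obtain ⟨l₂, w₂, r', rfl, hr', h₂⟩ := exists_rbf_of_rf hcomp hrf₂
  obtain ⟨hmw₁, hmr, hlw₁, hlr₁, -⟩ := hY.rbf_wf _ _ _ h₁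
  obtain ⟨hmw₂, hmr', hlw₂, hlr₂, -⟩ := hY.rbf_wf _ _ _ h₂
  obtain rfl := eq_of_isRead hY hcomp hmr' hmr hr' (Arm.Event.isRead_of_mem_rangeR hlr₂)
    (Arm.Event.isRead_of_mem_rangeR hlr₁)
  have e₁ : (Y.lab w₁).rangeW = (Y.lab r').rangeR := by
    rw [rangeW_eq hcomp hmw₁ (Arm.Event.isWrite_of_mem_rangeW hlw₁),
      rangeR_eq hcomp hmr' (Arm.Event.isRead_of_mem_rangeR hlr₂)]
    exact hW₁
  have e₂ : (Y.lab w₂).rangeW = (Y.lab r').rangeR := by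
    rw [rangeW_eq hcomp hmw₂ (Arm.Event.isWrite_of_mem_rangeW hlw₂),
      rangeR_eq hcomp hmr' (Arm.Event.isRead_of_mem_rangeR hlr₂)]
    exact hW₂
  by_contra hne
  have hne' : w₁ ≠ w₂ := fun h => hne (congrArg src h)
  rcases (hY.cob_order l₁).total w₁ ⟨hmw₁, hlw₁⟩ w₂ ⟨hmw₂, e₂ ▸ hlr₁⟩ hne' with h | h
  · exact com_asymm hV (com_of_frb hY hV ⟨w₁, h₁, h⟩) (com_of_rbf hY hV h₂)
  · rcases (hY.cob_order l₂).total w₁ ⟨hmw₁, e₁ ▸ hlr₂⟩ w₂ ⟨hmw₂, hlw₂⟩ hne' with h' | h'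
    · exact com_asymm hV (com_of_cob hY hV h) (com_of_cob hY hV h')
    · exact com_asymm hV (com_of_frb hY hV ⟨w₂, h₂, h'⟩) (com_of_rbf hY hV h₁)

theorem scAtomics : (X.withTot tot).SCAtomics := by
  rintro W R ⟨hrf, -⟩ ⟨W', hW', hWW', hWR, hcase⟩
  change tot W W' at hWW'
  change tot W' R at hWR
  obtain ⟨l, w, r, rfl, rfl, hwr⟩ := exists_rbf_of_rf hcomp hrf
  obtain ⟨hw, hr, hlw, hlr, -⟩ := hY.rbf_wf _ _ _ hwr
  have hlW : l ∈ (X.lab (src w)).rangeW :=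
    rangeW_eq hcomp hw (Arm.Event.isWrite_of_mem_rangeW hlw) ▸ hlw
  have hlR : l ∈ (X.lab (src r)).rangeR :=
    rangeR_eq hcomp hr (Arm.Event.isRead_of_mem_rangeR hlr) ▸ hlr
  -- Each case equates the range of `W'` with that of `R` or `W`, so `W'` writes the very byte `l`
  -- on which `R` reads from `W`.
  have hlW' : l ∈ (X.lab W').rangeW := by
    rcases hcase with ⟨h, -⟩ | ⟨h, -⟩ | ⟨h, -⟩
    · exact h.symm ▸ hlR
    · exact h ▸ hlW
    · exact h.symm ▸ hlR
  obtain ⟨w', hw', rfl, hlw'⟩ :=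
    exists_store_of_mem hcomp (htot.strictTotal.mem _ _ hWR).1 hlW'
  have hLA' := isLA_of_seqCst hcomp hw' hW'
  have cob_of_seqCst : (X.lab (src w)).ord = JS.Mode.seqCst → Y.cob l w w' := fun hW => by
    refine ((hY.cob_order l).total w ⟨hw, hlw⟩ w' ⟨hw', hlw'⟩ ?_).resolve_right fun h => ?_
    · rintro rfl
      exact htot.strictTotal.irrefl _ hWW'
    · exact not_tot_of_com hY hcomp htot hLA' (isLA_of_seqCst hcomp hw hW)
        (com_of_cob hY hV h) hWW'
  have not_cob_of_seqCst : (X.lab (src r)).ord = JS.Mode.seqCst → ¬ Y.cob l w w' := fun hR h =>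
    not_tot_of_com hY hcomp htot (isLA_of_seqCst hcomp hr hR) hLA'
      (com_of_frb hY hV ⟨w, hwr, h⟩) hWR
  -- Coherence from `w` to `w'` comes from `tot` when `W` is SeqCst and from `hb` in the third case.
  -- The resulting from-read contradicts `tot` when `R` is SeqCst and `hb` in the second case.
  rcases hcase with ⟨-, hsw⟩ | ⟨-, hW, hhb⟩ | ⟨-, hhb, hR⟩
  · rcases hsw with ⟨-, -, hW, hR⟩ | h
    · exact not_cob_of_seqCst hR (cob_of_seqCst hW)
    · exact hsync _ _ h
  · refine not_hb_of_com hX hsync hY hcomp hV htot hr hw' ?_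
      (com_of_frb hY hV ⟨w, hwr, cob_of_seqCst hW⟩) hhb
    change (X.lab (src w')).ord = _ at hW'
    simp [hW']
  · exact not_cob_of_seqCst hR (cob_of_hb hX hsync hY hcomp hV htot hw hw' hlw hlw' hhb)

theorem valid : (X.withTot tot).Valid :=
  ⟨fun _ _ h => tot_of_hb hX hsync hY hcomp hV htot h,
    hbConsistency2 hX hsync hY hcomp hV htot, hbConsistency3 hX hsync hY hcomp hV htot,
    tearFreeReads hY hcomp hV, scAtomics hX hsync hY hcomp hV htot⟩

end Validity

end Compilation.CompilesTo

theorem mainTheorem2 {Addr ι κ : Type*}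
    (X : JS.BaseExecution Addr ι) (Y : Arm.Execution Addr κ) (src : κ → ι)
    (hX : X.ThreadLocalWF) (hsync : X.NoAdditionalSync) (haligned : X.TypedArrayAccesses)
    (hY : Y.WellFormed) (hcomp : Compilation.CompilesTo X Y src) (hvalid : Y.Valid) :
    (∃ tot : ι → ι → Prop,
      RelaxedMemory.LinearExtension X.evs (Compilation.totBase X Y src) tot) ∧
    ∀ tot : ι → ι → Prop,
      RelaxedMemory.LinearExtension X.evs (Compilation.totBase X Y src) tot →
        (X.withTot tot).WellFormed ∧ (X.withTot tot).Valid := by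
  open Compilation.CompilesTo in
  exact ⟨RelaxedMemory.exists_linearExtension (fun _ _ => totBase_mem hX hY hcomp)
    (totBase_acyclic hX hY hcomp hvalid), fun tot htot =>
    ⟨wellFormed hX hY hcomp hvalid htot, valid hX hsync hY hcomp hvalid htot⟩⟩
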